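/- Let $A\in\mathbb R^{n\times n}$, $B\in\mathbb R^{n\times m}$, let $Q,Q_T\in\mathbb R^{n\times n}$ be (symmetric) positive semidefinite and $R\in\mathbb R^{m\times m}$ (symmetric) positive definite. For a horizon $T\ge 0$, disturbances $d_0,\dots,d_{T-1}\in\mathbb R^n$ and $x_0\in\mathbb R^n$, consider $$x_{t+1}=Ax_t+Bu_t+d_t\quad(0\le t<T),\qquad \text{cost}=x_T^\top Q_Tx_T+\sum_{t=0}^{T-1}\bigl(x_t^\top Qx_t+u_t^\top Ru_t\bigr).$$ Let $P_T=Q_T$ and, for $t<T$ (including $t<0$), $$P_t=A^\top\bigl(P_{t+1}-P_{t+1}B(B^\top P_{t+1}B+R)^{-1}B^\top P_{t+1}\bigr)A+Q,\qquad K_t=(B^\top P_{t+1}B+R)^{-1}B^\top P_{t+1}A .$$ $P_t$ and $K_t$ depend on $t$ and $T$ only through $T-t$. Let $J_0^w(x_0)$ be the cost of the blind policy $u_t=-K_tx_t$ on the trajectory with the disturbances, and let $V_0^w(x_0)$ be the cost of the optimal offline policy, that is, the minimum of the cost over all policies when $d_0,\dots,d_{T-1}$ are known in advance. Below, $\|\cdot\|$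 is the Euclidean norm of vectors and the spectral norm of matrices. Assume that $(A,B)$ is controllable, that $Q=L^\top L$ with $(A,L)$ observable, and that there is $\gamma>0$ with $\|A-BK_t\|<1-\gamma$ for all $t<T$ (including $t<0$). Then: (i) The minimum defining $V_0^w(x_0)$ is attained, and there are constants $C_1,C_2\ge 0$ depending only on $A,B,Q,Q_T,R$ (in particular not on $T$) such that for every $T$, every $x_0$, every $D\subseteq\{0,\dots,T-1\}$ and all disturbances with $d_t=0$ for $t\notin D$ and $\|d_t\|\le\hat w$ for $t\in D$, $$|J_0^w(x_0)-V_0^w(x_0)|\le C_1\,|D|\,\hat w\,\|x_0\|+C_2\,|D|^2\hat w^2 .$$ (ii) There is $\hat P\ge 1$ with $\|P_t\|\le\hat P$ for all $t\le T$ (including $t<0$), independent of $T$; and for every such $\hat P$, in the setting of (i), $$|J_0^w(x_0)-V_0^w(x_0)|\le 2|D|\hat w\hat P\,(2\|x_0\|+\hat w)+|D|^2\hat w^2(2\hat P^2+3\hat P)+\frac{|D|^2\,\hat w\,\hat P\,(3\hat P\hat w+\gamma^{-2})\,\|B\|^2}{\lambda_{\min}(R)},$$ where $\lambda_{\min}(R)$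 is the smallest eigenvalue of $R$. -/

import Mathlib

open scoped Matrix Matrix.Norms.L2Operator

namespace SparseLQR

noncomputable section

/-- The Euclidean norm of a vector. -/
def l2norm {n : ℕ} (x : Fin n → ℝ) : ℝ := ‖WithLp.toLp 2 x‖

/-- The smallest eigenvalue of a real symmetric matrix. -/
def minEigenvalue {m : ℕ} (R : Matrix (Fin m) (Fin m) ℝ) : ℝ := sInf (spectrum ℝ R)

/-- The Kalman controllability matrix `[B, A B, …, A ^ (n - 1) B]`. -/
def controllabilityMatrix {n m : ℕ} (A : Matrix (Fin n) (Fin n) ℝ)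
    (B : Matrix (Fin n) (Fin m) ℝ) : Matrix (Fin n) (Fin n × Fin m) ℝ :=
  Matrix.of fun i kj => (A ^ (kj.1 : ℕ) * B) i kj.2

/-- `(A, B)` is controllable: the controllability matrix has full rank. -/
def Controllable {n m : ℕ} (A : Matrix (Fin n) (Fin n) ℝ)
    (B : Matrix (Fin n) (Fin m) ℝ) : Prop :=
  (controllabilityMatrix A B).rank = n

/-- The observability matrix, with the blocks `L, L A, …, L A ^ (n - 1)` stacked vertically. -/
def observabilityMatrix {n p : ℕ} (A : Matrix (Fin n) (Fin n) ℝ)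
    (L : Matrix (Fin p) (Fin n) ℝ) : Matrix (Fin n × Fin p) (Fin n) ℝ :=
  Matrix.of fun kj i => (L * A ^ (kj.1 : ℕ)) kj.2 i

/-- `(A, L)` is observable: the observability matrix has full rank. -/
def Observable {n p : ℕ} (A : Matrix (Fin n) (Fin n) ℝ)
    (L : Matrix (Fin p) (Fin n) ℝ) : Prop :=
  (observabilityMatrix A L).rank = n

/-- The Riccati sequence, indexed by the number `s` of steps to go: for a problem with horizon `T`,
the matrix `P_t` is `riccati A B Q QT R (T - t)`; in particular `P_T = QT`. -/
def riccati {n m : ℕ} (A : Matrix (Fin n) (Fin n) ℝ) (B : Matrix (Fin n) (Fin m) ℝ)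
    (Q QT : Matrix (Fin n) (Fin n) ℝ) (R : Matrix (Fin m) (Fin m) ℝ) :
    ℕ → Matrix (Fin n) (Fin n) ℝ
  | 0 => QT
  | s + 1 =>
    let P := riccati A B Q QT R s
    Aᵀ * (P - P * B * (Bᵀ * P * B + R)⁻¹ * Bᵀ * P) * A + Q

/-- The LQR feedback matrix computed from the Riccati matrix with `s` steps to go: for a problem
with horizon `T`, the matrix `K_t` (which is computed from `P_{t+1}`) is
`gain A B Q QT R (T - (t + 1))`. -/
def gain {n m : ℕ} (A : Matrix (Fin n) (Fin n) ℝ) (B : Matrix (Fin n) (Fin m) ℝ)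
    (Q QT : Matrix (Fin n) (Fin n) ℝ) (R : Matrix (Fin m) (Fin m) ℝ) (s : ℕ) :
    Matrix (Fin m) (Fin n) ℝ :=
  (Bᵀ * riccati A B Q QT R s * B + R)⁻¹ * Bᵀ * riccati A B Q QT R s * A

/-- The trajectory `x_{t+1} = A x_t + B u_t + d_t` from `x0` under the policy `u_t = π t x_t`. -/
def state {n m : ℕ} (A : Matrix (Fin n) (Fin n) ℝ) (B : Matrix (Fin n) (Fin m) ℝ)
    (d : ℕ → Fin n → ℝ) (π : ℕ → (Fin n → ℝ) → (Fin m → ℝ)) (x0 : Fin n → ℝ) :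
    ℕ → Fin n → ℝ
  | 0 => x0
  | t + 1 => A *ᵥ state A B d π x0 t + B *ᵥ π t (state A B d π x0 t) + d t

/-- The quadratic cost over the horizon `T` of the policy `π` under the disturbances `d`. -/
def cost {n m : ℕ} (A : Matrix (Fin n) (Fin n) ℝ) (B : Matrix (Fin n) (Fin m) ℝ)
    (Q QT : Matrix (Fin n) (Fin n) ℝ) (R : Matrix (Fin m) (Fin m) ℝ) (T : ℕ)
    (d : ℕ → Fin n → ℝ) (x0 : Fin n → ℝ) (π : ℕ → (Fin n → ℝ) → (Fin m → ℝ)) : ℝ :=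
  state A B d π x0 T ⬝ᵥ (QT *ᵥ state A B d π x0 T)
    + ∑ t ∈ Finset.range T,
        (state A B d π x0 t ⬝ᵥ (Q *ᵥ state A B d π x0 t)
          + π t (state A B d π x0 t) ⬝ᵥ (R *ᵥ π t (state A B d π x0 t)))

/-- The blind online policy `u_t = - K_t x_t` for the horizon `T`. -/
def blindPolicy {n m : ℕ} (A : Matrix (Fin n) (Fin n) ℝ) (B : Matrix (Fin n) (Fin m) ℝ)
    (Q QT : Matrix (Fin n) (Fin n) ℝ) (R : Matrix (Fin m) (Fin m) ℝ) (T : ℕ) :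
    ℕ → (Fin n → ℝ) → (Fin m → ℝ) :=
  fun t x => -(gain A B Q QT R (T - (t + 1)) *ᵥ x)

/-- The cost of the blind online policy on the trajectory perturbed by `d`. -/
def blindCost {n m : ℕ} (A : Matrix (Fin n) (Fin n) ℝ) (B : Matrix (Fin n) (Fin m) ℝ)
    (Q QT : Matrix (Fin n) (Fin n) ℝ) (R : Matrix (Fin m) (Fin m) ℝ) (T : ℕ)
    (d : ℕ → Fin n → ℝ) (x0 : Fin n → ℝ) : ℝ :=
  cost A B Q QT R T d x0 (blindPolicy A B Q QT R T)

/-- The cost of the optimal offline policy, that is, the least cost among all policies, which may be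
chosen with complete knowledge of the disturbances `d`. -/
def offlineCost {n m : ℕ} (A : Matrix (Fin n) (Fin n) ℝ) (B : Matrix (Fin n) (Fin m) ℝ)
    (Q QT : Matrix (Fin n) (Fin n) ℝ) (R : Matrix (Fin m) (Fin m) ℝ) (T : ℕ)
    (d : ℕ → Fin n → ℝ) (x0 : Fin n → ℝ) : ℝ :=
  ⨅ π : ℕ → (Fin n → ℝ) → (Fin m → ℝ), cost A B Q QT R T d x0 π

/-- `d` is a disturbance sequence over the horizon `T` that vanishes outside the set `D` of times,
and whose values on `D` have norm at most `w`. -/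
structure IsSparseDisturbance {n : ℕ} (T : ℕ) (D : Finset ℕ) (w : ℝ)
    (d : ℕ → Fin n → ℝ) : Prop where
  subset : D ⊆ Finset.range T
  eq_zero : ∀ t < T, t ∉ D → d t = 0
  norm_le : ∀ t ∈ D, l2norm (d t) ≤ w

end

end SparseLQR

/-!
With `s + 1` steps to go let `P`, `K` be the Riccati matrix and the gain, `H = Bᵀ P B + R` the
Hessian of the stage problem, `q` half the linear coefficient of the disturbed cost-to-go after the
stage, `g = P d + q` and `h = H⁻¹ Bᵀ g`. Completing the square in `u` (`stage_complete_square`)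
gives, along every trajectory,

  `stage cost + W' - W = dᵀ P d + 2 qᵀ d + (u + K x + h)ᵀ H (u + K x + h) - hᵀ H h`,

where `W = xᵀ P₊ x + 2 q₊ᵀ x` and `W' = x'ᵀ P x' + 2 qᵀ x'` are the quadratic-plus-linear parts of
the cost-to-go before and after the stage, `P₊` being the next Riccati matrix and
`q₊ = (A - B K)ᵀ g`. Summing over time (`cost_eq`), the policy `u = -(K x + h)` is optimal offline,
and the blind policy `u = -K x` exceeds it by exactly `∑ hᵀ H h`.

This regret does not involve the initial state. Evaluated at the initial state `0`, where the
offline cost is nonnegative, it is at most the blind cost `∑ (dᵀ P d + 2 qᵀ d)`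
(`regret_le_blindConst`). As the closed-loop matrices are contractions, `‖q‖ ≤ Phat * ∑ ‖d‖`, so the
regret is at most `3 * Phat * (∑ ‖d‖) ^ 2 ≤ 3 * Phat * |D| ^ 2 * w ^ 2`
(`abs_blindCost_sub_offlineCost_le`). This yields the bound with constants, with `C₁ = 0`, and it is
one of the terms of the explicit bound, whose other terms are nonnegative.

The Riccati sequence is bounded because the optimal undisturbed cost is at most the cost of the
stationary policy given by a single stabilizing gain (`exists_norm_riccati_le`).
-/

namespace SparseLQR

noncomputable section

open Matrix

/-! ### Euclidean norms and quadratic forms -/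

lemma l2norm_nonneg {n : ℕ} (x : Fin n → ℝ) : 0 ≤ l2norm x := norm_nonneg _

lemma l2norm_zero {n : ℕ} : l2norm (0 : Fin n → ℝ) = 0 := by simp [l2norm]

lemma l2norm_add_le {n : ℕ} (x y : Fin n → ℝ) : l2norm (x + y) ≤ l2norm x + l2norm y := by
  simpa [l2norm] using norm_add_le (WithLp.toLp 2 x) (WithLp.toLp 2 y)

lemma dotProduct_le_l2norm_mul {n : ℕ} (x y : Fin n → ℝ) : x ⬝ᵥ y ≤ l2norm x * l2norm y := by
  have h := real_inner_le_norm (WithLp.toLp 2 x) (WithLp.toLp 2 y)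
  rwa [EuclideanSpace.inner_toLp_toLp, star_trivial, dotProduct_comm] at h

lemma dotProduct_self_eq_l2norm_sq {n : ℕ} (x : Fin n → ℝ) : x ⬝ᵥ x = l2norm x ^ 2 := by
  have h := real_inner_self_eq_norm_sq (WithLp.toLp 2 x)
  rwa [EuclideanSpace.inner_toLp_toLp, star_trivial] at h

lemma l2norm_mulVec_le {n m : ℕ} (M : Matrix (Fin n) (Fin m) ℝ) (x : Fin m → ℝ) :
    l2norm (M *ᵥ x) ≤ ‖M‖ * l2norm x :=
  Matrix.l2_opNorm_mulVec M (WithLp.toLp 2 x)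

lemma dotProduct_mulVec_le {n m : ℕ} (M : Matrix (Fin n) (Fin m) ℝ) (x : Fin n → ℝ)
    (y : Fin m → ℝ) : x ⬝ᵥ (M *ᵥ y) ≤ ‖M‖ * (l2norm x * l2norm y) :=
  calc x ⬝ᵥ (M *ᵥ y) ≤ l2norm x * l2norm (M *ᵥ y) := dotProduct_le_l2norm_mul _ _
    _ ≤ l2norm x * (‖M‖ * l2norm y) :=
      mul_le_mul_of_nonneg_left (l2norm_mulVec_le M y) (l2norm_nonneg x)
    _ = _ := by ring

lemma opNorm_le_of_l2norm_mulVec_le {n m : ℕ} {M : Matrix (Fin n) (Fin m) ℝ} {c : ℝ}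
    (hc : 0 ≤ c) (h : ∀ x, l2norm (M *ᵥ x) ≤ c * l2norm x) : ‖M‖ ≤ c := by
  rw [Matrix.l2_opNorm_def]
  exact ContinuousLinearMap.opNorm_le_bound _ hc fun x => h (WithLp.ofLp x)

lemma norm_transpose {n m : ℕ} (M : Matrix (Fin n) (Fin m) ℝ) : ‖Mᵀ‖ = ‖M‖ := by
  rw [← conjTranspose_eq_transpose_of_trivial, Matrix.l2_opNorm_conjTranspose]

lemma quadForm_nonneg {n : ℕ} {M : Matrix (Fin n) (Fin n) ℝ} (hM : M.PosSemidef)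
    (x : Fin n → ℝ) : 0 ≤ x ⬝ᵥ (M *ᵥ x) := by
  simpa using hM.dotProduct_mulVec_nonneg x

lemma dotProduct_transpose_mulVec {n m : ℕ} (M : Matrix (Fin m) (Fin n) ℝ) (x : Fin n → ℝ)
    (y : Fin m → ℝ) : x ⬝ᵥ (Mᵀ *ᵥ y) = (M *ᵥ x) ⬝ᵥ y := by
  rw [dotProduct_mulVec, vecMul_transpose]

open scoped MatrixOrder in
/-- The spectral norm of a positive semidefinite matrix is controlled by its quadratic form: for
`M = Sᴴ * S` the form is `‖S x‖ ^ 2`, and `‖M‖ = ‖S‖ ^ 2`. -/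
lemma norm_le_of_quadForm_le {n : ℕ} {M : Matrix (Fin n) (Fin n) ℝ} (hM : M.PosSemidef) {c : ℝ}
    (hc : 0 ≤ c) (h : ∀ x, x ⬝ᵥ (M *ᵥ x) ≤ c * l2norm x ^ 2) : ‖M‖ ≤ c := by
  obtain ⟨S, rfl⟩ := CStarAlgebra.nonneg_iff_eq_star_mul_self.mp hM.nonneg
  have hS : ‖S‖ ≤ √c := by
    refine opNorm_le_of_l2norm_mulVec_le (Real.sqrt_nonneg c) fun x => ?_
    have hx := h x
    rw [star_eq_conjTranspose, conjTranspose_eq_transpose_of_trivial, ← mulVec_mulVec,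
      dotProduct_transpose_mulVec, dotProduct_self_eq_l2norm_sq] at hx
    refine abs_le_of_sq_le_sq' ?_ (mul_nonneg (Real.sqrt_nonneg c) (l2norm_nonneg x)) |>.2
    rwa [mul_pow, Real.sq_sqrt hc]
  calc ‖star S * S‖ = ‖S‖ * ‖S‖ := Matrix.l2_opNorm_conjTranspose_mul_self S
    _ ≤ √c * √c := mul_self_le_mul_self (norm_nonneg S) hS
    _ = c := Real.mul_self_sqrt hc

lemma minEigenvalue_nonneg {m : ℕ} {R : Matrix (Fin m) (Fin m) ℝ} (hR : R.PosSemidef) :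
    0 ≤ minEigenvalue R := by
  refine Real.sInf_nonneg fun r hr => ?_
  rw [hR.isHermitian.spectrum_real_eq_range_eigenvalues] at hr
  obtain ⟨i, rfl⟩ := hr
  exact hR.eigenvalues_nonneg i

lemma transpose_eq_of_isHermitian {n : ℕ} {M : Matrix (Fin n) (Fin n) ℝ} (hM : M.IsHermitian) :
    Mᵀ = M :=
  (conjTranspose_eq_transpose_of_trivial M).symm.trans hM.eq

lemma dotProduct_mulVec_comm {n : ℕ} {M : Matrix (Fin n) (Fin n) ℝ} (hM : Mᵀ = M)
    (x y : Fin n → ℝ) : x ⬝ᵥ (M *ᵥ y) = y ⬝ᵥ (M *ᵥ x) := by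
  conv_lhs => rw [← hM, dotProduct_transpose_mulVec, dotProduct_comm]

/-! ### Completing the square in one stage -/

/-- One stage of dynamic programming. If the cost-to-go after the stage is
`z ↦ zᵀ P z + 2 qᵀ z`, then the total cost of the control `u` at the state `x` splits into the
cost-to-go `xᵀ P' x + 2 q'ᵀ x` before the stage, a constant, and a quadratic form in the deviation
of `u` from the optimal control `-(K x + h)`. -/
lemma stage_complete_square {n m : ℕ} {A : Matrix (Fin n) (Fin n) ℝ}
    {B : Matrix (Fin n) (Fin m) ℝ} {Q P P' : Matrix (Fin n) (Fin n) ℝ}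
    {R H : Matrix (Fin m) (Fin m) ℝ} {K : Matrix (Fin m) (Fin n) ℝ}
    (hP : Pᵀ = P) (hHs : Hᵀ = H) (hH : H = Bᵀ * P * B + R) (hK : H * K = Bᵀ * P * A)
    (hP' : P' = Aᵀ * P * A - Kᵀ * H * K + Q)
    (x d q q' g : Fin n → ℝ) (u h : Fin m → ℝ) (hg : g = P *ᵥ d + q) (hh : H *ᵥ h = Bᵀ *ᵥ g)
    (hq' : q' = (A - B * K)ᵀ *ᵥ g) :
    x ⬝ᵥ (Q *ᵥ x) + u ⬝ᵥ (R *ᵥ u)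
        + ((A *ᵥ x + B *ᵥ u + d) ⬝ᵥ (P *ᵥ (A *ᵥ x + B *ᵥ u + d))
          + 2 * (q ⬝ᵥ (A *ᵥ x + B *ᵥ u + d)))
      = x ⬝ᵥ (P' *ᵥ x) + 2 * (q' ⬝ᵥ x) + (d ⬝ᵥ (P *ᵥ d) + 2 * (q ⬝ᵥ d))
        + (u + K *ᵥ x + h) ⬝ᵥ (H *ᵥ (u + K *ᵥ x + h)) - h ⬝ᵥ (H *ᵥ h) := by
  have e1 : x ⬝ᵥ (P' *ᵥ x) = (A *ᵥ x) ⬝ᵥ (P *ᵥ (A *ᵥ x))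
      - (K *ᵥ x) ⬝ᵥ (H *ᵥ (K *ᵥ x)) + x ⬝ᵥ (Q *ᵥ x) := by
    rw [hP', add_mulVec, sub_mulVec, dotProduct_add, dotProduct_sub]
    simp only [← mulVec_mulVec, dotProduct_transpose_mulVec]
  have e2 : q' ⬝ᵥ x = g ⬝ᵥ (A *ᵥ x) - g ⬝ᵥ (B *ᵥ (K *ᵥ x)) := by
    rw [hq', dotProduct_comm, dotProduct_transpose_mulVec, dotProduct_comm, sub_mulVec,
      dotProduct_sub, ← mulVec_mulVec]
  have e3 : u ⬝ᵥ (H *ᵥ u) = (B *ᵥ u) ⬝ᵥ (P *ᵥ (B *ᵥ u)) + u ⬝ᵥ (R *ᵥ u) := by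
    rw [hH, add_mulVec, dotProduct_add]
    simp only [← mulVec_mulVec, dotProduct_transpose_mulVec]
  have e4 : u ⬝ᵥ (H *ᵥ (K *ᵥ x)) = (B *ᵥ u) ⬝ᵥ (P *ᵥ (A *ᵥ x)) := by
    rw [mulVec_mulVec, hK]
    simp only [← mulVec_mulVec, dotProduct_transpose_mulVec]
  have e5 (v : Fin m → ℝ) : v ⬝ᵥ (H *ᵥ h) = g ⬝ᵥ (B *ᵥ v) := by
    rw [hh, dotProduct_transpose_mulVec, dotProduct_comm]
  have e6 (y : Fin n → ℝ) : g ⬝ᵥ y = y ⬝ᵥ (P *ᵥ d) + q ⬝ᵥ y := by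
    rw [hg, add_dotProduct, dotProduct_comm]
  have e7 := dotProduct_mulVec_comm hHs (K *ᵥ x) u
  have e8 := dotProduct_mulVec_comm hHs h u
  have e9 := dotProduct_mulVec_comm hHs h (K *ᵥ x)
  have e10 := dotProduct_mulVec_comm hP (B *ᵥ u) (A *ᵥ x)
  have e11 := dotProduct_mulVec_comm hP d (A *ᵥ x)
  have e12 := dotProduct_mulVec_comm hP d (B *ᵥ u)
  have e13 := e5 u
  have e14 := e5 (K *ᵥ x)
  have e15 := e6 (A *ᵥ x)
  have e16 := e6 (B *ᵥ u)
  simp only [mulVec_add, dotProduct_add, add_dotProduct]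
  linear_combination -e1 - 2 * e2 - e3 - 2 * e4 - e7 - e8 - e9 - e10 + e11 + e12 - 2 * e13
    - 2 * e14 - 2 * e15 - 2 * e16

/-! ### The Riccati sequence -/

section Riccati

variable {n m : ℕ} (A : Matrix (Fin n) (Fin n) ℝ) (B : Matrix (Fin n) (Fin m) ℝ)
  (Q QT : Matrix (Fin n) (Fin n) ℝ) (R : Matrix (Fin m) (Fin m) ℝ)

/-- The Hessian `Bᵀ P B + R` of the stage problem in the control, with `s + 1` steps to go. -/
def controlHessian (s : ℕ) : Matrix (Fin m) (Fin m) ℝ :=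
  Bᵀ * riccati A B Q QT R s * B + R

variable {A B Q QT R}

lemma controlHessian_posDef_of_riccati (hR : R.PosDef) {s : ℕ}
    (hP : (riccati A B Q QT R s).PosSemidef) : (controlHessian A B Q QT R s).PosDef := by
  have h := hP.conjTranspose_mul_mul_same B
  rw [conjTranspose_eq_transpose_of_trivial] at h
  exact hR.posSemidef_add h

lemma controlHessian_mul_gain {s : ℕ} (hH : (controlHessian A B Q QT R s).PosDef) :
    controlHessian A B Q QT R s * gain A B Q QT R s = Bᵀ * riccati A B Q QT R s * A := by
  have hu : IsUnit (controlHessian A B Q QT R s).det :=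
    (Matrix.isUnit_iff_isUnit_det _).mp hH.isUnit
  rw [gain, ← controlHessian]
  simp only [Matrix.mul_assoc]
  rw [Matrix.mul_nonsing_inv_cancel_left _ _ hu]

lemma riccati_succ_of_posSemidef (hR : R.PosDef) {s : ℕ}
    (hP : (riccati A B Q QT R s).PosSemidef) :
    riccati A B Q QT R (s + 1) = Aᵀ * riccati A B Q QT R s * A
      - (gain A B Q QT R s)ᵀ * controlHessian A B Q QT R s * gain A B Q QT R s + Q := by
  have hH := controlHessian_posDef_of_riccati hR hP
  have hK := controlHessian_mul_gain hH
  have hPt : (riccati A B Q QT R s)ᵀ = riccati A B Q QT R s :=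
    transpose_eq_of_isHermitian hP.isHermitian
  have hHt : (controlHessian A B Q QT R s)ᵀ = controlHessian A B Q QT R s :=
    transpose_eq_of_isHermitian hH.isHermitian
  have hKt : (gain A B Q QT R s)ᵀ * controlHessian A B Q QT R s
      = Aᵀ * riccati A B Q QT R s * B := by
    have := congrArg transpose hK
    simpa [transpose_mul, hPt, hHt, Matrix.mul_assoc] using this
  rw [hKt, riccati, gain]
  simp only [Matrix.mul_sub, Matrix.sub_mul, Matrix.mul_assoc]

/-- `stage_complete_square` for the Riccati sequence; positive semidefiniteness of the current term
is a hypothesis because this identity is what carries it over to the next term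
(`riccati_posSemidef`). -/
lemma stage_cost_add (hR : R.PosDef) {s : ℕ} (hP : (riccati A B Q QT R s).PosSemidef)
    (x d q g : Fin n → ℝ) (u h : Fin m → ℝ) (hg : g = riccati A B Q QT R s *ᵥ d + q)
    (hh : controlHessian A B Q QT R s *ᵥ h = Bᵀ *ᵥ g) :
    x ⬝ᵥ (Q *ᵥ x) + u ⬝ᵥ (R *ᵥ u)
        + ((A *ᵥ x + B *ᵥ u + d) ⬝ᵥ (riccati A B Q QT R s *ᵥ (A *ᵥ x + B *ᵥ u + d))
          + 2 * (q ⬝ᵥ (A *ᵥ x + B *ᵥ u + d)))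
      = x ⬝ᵥ (riccati A B Q QT R (s + 1) *ᵥ x)
        + 2 * (((A - B * gain A B Q QT R s)ᵀ *ᵥ g) ⬝ᵥ x)
        + (d ⬝ᵥ (riccati A B Q QT R s *ᵥ d) + 2 * (q ⬝ᵥ d))
        + (u + gain A B Q QT R s *ᵥ x + h)
          ⬝ᵥ (controlHessian A B Q QT R s *ᵥ (u + gain A B Q QT R s *ᵥ x + h))
        - h ⬝ᵥ (controlHessian A B Q QT R s *ᵥ h) :=
  have hH := controlHessian_posDef_of_riccati hR hP
  stage_complete_square (transpose_eq_of_isHermitian hP.isHermitian)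
    (transpose_eq_of_isHermitian hH.isHermitian) rfl (controlHessian_mul_gain hH)
    (riccati_succ_of_posSemidef hR hP) x d q _ g u h hg hh rfl

/-- The Riccati recursion as the Bellman equation of the undisturbed problem. -/
lemma quadForm_riccati_succ (hR : R.PosDef) {s : ℕ} (hP : (riccati A B Q QT R s).PosSemidef)
    (x : Fin n → ℝ) (u : Fin m → ℝ) :
    x ⬝ᵥ (Q *ᵥ x) + u ⬝ᵥ (R *ᵥ u)
        + (A *ᵥ x + B *ᵥ u) ⬝ᵥ (riccati A B Q QT R s *ᵥ (A *ᵥ x + B *ᵥ u))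
      = x ⬝ᵥ (riccati A B Q QT R (s + 1) *ᵥ x)
        + (u + gain A B Q QT R s *ᵥ x)
          ⬝ᵥ (controlHessian A B Q QT R s *ᵥ (u + gain A B Q QT R s *ᵥ x)) := by
  simpa using stage_cost_add hR hP x 0 0 0 u 0 (by simp) (by simp)

lemma riccati_posSemidef (hQ : Q.PosSemidef) (hQT : QT.PosSemidef) (hR : R.PosDef) (s : ℕ) :
    (riccati A B Q QT R s).PosSemidef := by
  induction s with
  | zero => exact hQT
  | succ s ih =>
    have hPt : (riccati A B Q QT R s)ᵀ = riccati A B Q QT R s :=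
      transpose_eq_of_isHermitian ih.isHermitian
    have hHt : (controlHessian A B Q QT R s)ᵀ = controlHessian A B Q QT R s :=
      transpose_eq_of_isHermitian (controlHessian_posDef_of_riccati hR ih).isHermitian
    have hQt : Qᵀ = Q := transpose_eq_of_isHermitian hQ.isHermitian
    refine .of_dotProduct_mulVec_nonneg ?_ fun x => ?_
    · rw [IsHermitian, conjTranspose_eq_transpose_of_trivial, riccati_succ_of_posSemidef hR ih]
      simp [transpose_mul, hPt, hHt, hQt, Matrix.mul_assoc]
    · have h := quadForm_riccati_succ hR ih x (-(gain A B Q QT R s *ᵥ x))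
      rw [neg_add_cancel, zero_dotProduct, add_zero] at h
      rw [star_trivial, ← h]
      exact add_nonneg (add_nonneg (quadForm_nonneg hQ x) (quadForm_nonneg hR.posSemidef _))
        (quadForm_nonneg ih _)

lemma controlHessian_posDef (hQ : Q.PosSemidef) (hQT : QT.PosSemidef) (hR : R.PosDef) (s : ℕ) :
    (controlHessian A B Q QT R s).PosDef :=
  controlHessian_posDef_of_riccati hR (riccati_posSemidef hQ hQT hR s)

/-- A single feedback matrix `K` whose closed loop contracts the Euclidean norm already bounds the
Riccati sequence: the optimal cost over any horizon is at most that of the stationary policy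
`u = -K x`, which is dominated by a geometric series. -/
lemma exists_norm_riccati_le (hQ : Q.PosSemidef) (hQT : QT.PosSemidef) (hR : R.PosDef) {γ : ℝ}
    (hγ : 0 < γ) {K : Matrix (Fin m) (Fin n) ℝ} (hK : ‖A - B * K‖ ≤ 1 - γ) :
    ∃ Phat : ℝ, 1 ≤ Phat ∧ ∀ s : ℕ, ‖riccati A B Q QT R s‖ ≤ Phat := by
  have hγ1 : γ ≤ 1 := by linarith [norm_nonneg (A - B * K)]
  set c := ‖Q‖ + ‖R‖ * ‖K‖ ^ 2 with hc
  have hc0 : 0 ≤ c := by positivity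
  set b := 1 + ‖QT‖ + c / γ with hb
  have hb0 : 0 ≤ b := by positivity
  refine ⟨b, ?_, fun s => ?_⟩
  · have : 0 ≤ ‖QT‖ + c / γ := by positivity
    linarith
  refine norm_le_of_quadForm_le (riccati_posSemidef hQ hQT hR s) hb0 ?_
  induction s with
  | zero =>
    intro x
    have hQb : ‖QT‖ ≤ b := by
      have : 0 ≤ c / γ := by positivity
      linarith
    calc x ⬝ᵥ (QT *ᵥ x) ≤ ‖QT‖ * (l2norm x * l2norm x) := dotProduct_mulVec_le _ _ _
      _ ≤ b * l2norm x ^ 2 := by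
        rw [← sq]; exact mul_le_mul_of_nonneg_right hQb (sq_nonneg _)
  | succ s ih =>
    intro x
    have hP := riccati_posSemidef (A := A) (B := B) hQ hQT hR s
    have h := quadForm_riccati_succ hR hP x (-(K *ᵥ x))
    have hpos := quadForm_nonneg (controlHessian_posDef (A := A) (B := B) hQ hQT hR s).posSemidef
      (-(K *ᵥ x) + gain A B Q QT R s *ᵥ x)
    have hz : A *ᵥ x + B *ᵥ -(K *ᵥ x) = (A - B * K) *ᵥ x := by
      rw [mulVec_neg, mulVec_mulVec, ← sub_eq_add_neg, sub_mulVec]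
    have hu : -(K *ᵥ x) ⬝ᵥ (R *ᵥ -(K *ᵥ x)) = (K *ᵥ x) ⬝ᵥ (R *ᵥ (K *ᵥ x)) := by
      simp [mulVec_neg]
    rw [hz, hu] at h
    have hx := l2norm_nonneg x
    have hKx : (K *ᵥ x) ⬝ᵥ (R *ᵥ (K *ᵥ x)) ≤ ‖R‖ * ‖K‖ ^ 2 * l2norm x ^ 2 :=
      calc _ ≤ ‖R‖ * (l2norm (K *ᵥ x) * l2norm (K *ᵥ x)) := dotProduct_mulVec_le _ _ _
        _ ≤ ‖R‖ * ((‖K‖ * l2norm x) * (‖K‖ * l2norm x)) :=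
          mul_le_mul_of_nonneg_left
            (mul_self_le_mul_self (l2norm_nonneg _) (l2norm_mulVec_le K x)) (norm_nonneg R)
        _ = _ := by ring
    have hQx : x ⬝ᵥ (Q *ᵥ x) ≤ ‖Q‖ * (l2norm x * l2norm x) := dotProduct_mulVec_le _ _ _
    have hzx : l2norm ((A - B * K) *ᵥ x) ≤ (1 - γ) * l2norm x :=
      (l2norm_mulVec_le _ x).trans (mul_le_mul_of_nonneg_right hK hx)
    have hPz := (ih ((A - B * K) *ᵥ x)).trans
      (mul_le_mul_of_nonneg_left (pow_le_pow_left₀ (l2norm_nonneg _) hzx 2) hb0)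
    -- `b` is a supersolution of the scalar recursion `b ↦ (1 - γ) ^ 2 * b + c`.
    have hbc : c + b * (1 - γ) ^ 2 ≤ b := by
      have h1 : c ≤ γ * b := by
        have : γ * (c / γ) = c := mul_div_cancel₀ c hγ.ne'
        nlinarith [norm_nonneg QT]
      nlinarith [mul_nonneg (mul_nonneg hb0 hγ.le) (sub_nonneg.mpr hγ1)]
    calc x ⬝ᵥ (riccati A B Q QT R (s + 1) *ᵥ x) ≤ (c + b * (1 - γ) ^ 2) * l2norm x ^ 2 := by
          rw [hc]; linarith
      _ ≤ b * l2norm x ^ 2 := mul_le_mul_of_nonneg_right hbc (sq_nonneg _)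

end Riccati

/-! ### The disturbed problem -/

section Disturbed

variable {n m : ℕ} (A : Matrix (Fin n) (Fin n) ℝ) (B : Matrix (Fin n) (Fin m) ℝ)
  (Q QT : Matrix (Fin n) (Fin n) ℝ) (R : Matrix (Fin m) (Fin m) ℝ) (T : ℕ) (d : ℕ → Fin n → ℝ)

/-- Half the linear coefficient of the disturbed cost-to-go, indexed, like `riccati`, by the number
`s` of steps to go; the disturbance acting with `s + 1` steps to go is `d (T - (s + 1))`. -/
def costLinear : ℕ → Fin n → ℝ
  | 0 => 0
  | s + 1 => (A - B * gain A B Q QT R s)ᵀ *ᵥ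
      (riccati A B Q QT R s *ᵥ d (T - (s + 1)) + costLinear s)

/-- The disturbance-dependent part of the optimal offline control: with `s + 1` steps to go that
control is `-(K x + h)`, where `K` is the gain and `h` is this vector. -/
def feedforward (s : ℕ) : Fin m → ℝ :=
  (controlHessian A B Q QT R s)⁻¹ *ᵥ
    (Bᵀ *ᵥ (riccati A B Q QT R s *ᵥ d (T - (s + 1)) + costLinear A B Q QT R T d s))

/-- The optimal policy when the disturbances are known in advance. -/
def offlinePolicy : ℕ → (Fin n → ℝ) → (Fin m → ℝ) :=
  fun t x => -(gain A B Q QT R (T - (t + 1)) *ᵥ x + feedforward A B Q QT R T d (T - (t + 1)))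

/-- The part of the blind cost that is present even when the initial state is zero. -/
def blindConst : ℝ :=
  ∑ t ∈ Finset.range T,
    (d t ⬝ᵥ (riccati A B Q QT R (T - (t + 1)) *ᵥ d t)
      + 2 * (costLinear A B Q QT R T d (T - (t + 1)) ⬝ᵥ d t))

/-- The excess of the blind cost over the offline cost. -/
def regret : ℝ :=
  ∑ t ∈ Finset.range T, feedforward A B Q QT R T d (T - (t + 1))
    ⬝ᵥ (controlHessian A B Q QT R (T - (t + 1)) *ᵥ feedforward A B Q QT R T d (T - (t + 1)))

/-- The value at `x0` of the quadratic cost-to-go of the blind policy. -/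
def blindValue (x0 : Fin n → ℝ) : ℝ :=
  x0 ⬝ᵥ (riccati A B Q QT R T *ᵥ x0) + 2 * (costLinear A B Q QT R T d T ⬝ᵥ x0)
    + blindConst A B Q QT R T d

/-- The control of the policy `π` at time `t`, relative to the optimal offline control. -/
def deviation (x0 : Fin n → ℝ) (π : ℕ → (Fin n → ℝ) → (Fin m → ℝ)) (t : ℕ) : Fin m → ℝ :=
  π t (state A B d π x0 t) + gain A B Q QT R (T - (t + 1)) *ᵥ state A B d π x0 t
    + feedforward A B Q QT R T d (T - (t + 1))

variable {A B Q QT R T d}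

/-- The cost of an arbitrary policy, with the square completed at every stage. -/
theorem cost_eq (hQ : Q.PosSemidef) (hQT : QT.PosSemidef) (hR : R.PosDef) (x0 : Fin n → ℝ)
    (π : ℕ → (Fin n → ℝ) → (Fin m → ℝ)) :
    cost A B Q QT R T d x0 π = blindValue A B Q QT R T d x0 - regret A B Q QT R T d
      + ∑ t ∈ Finset.range T, deviation A B Q QT R T d x0 π t
        ⬝ᵥ (controlHessian A B Q QT R (T - (t + 1)) *ᵥ deviation A B Q QT R T d x0 π t) := by
  set X := state A B d π x0 with hX
  set W : ℕ → ℝ := fun t => X t ⬝ᵥ (riccati A B Q QT R (T - t) *ᵥ X t)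
    + 2 * (costLinear A B Q QT R T d (T - t) ⬝ᵥ X t) with hW
  have hstage : ∀ t ∈ Finset.range T,
      X t ⬝ᵥ (Q *ᵥ X t) + π t (X t) ⬝ᵥ (R *ᵥ π t (X t))
        = (d t ⬝ᵥ (riccati A B Q QT R (T - (t + 1)) *ᵥ d t)
            + 2 * (costLinear A B Q QT R T d (T - (t + 1)) ⬝ᵥ d t))
          + deviation A B Q QT R T d x0 π t
            ⬝ᵥ (controlHessian A B Q QT R (T - (t + 1)) *ᵥ deviation A B Q QT R T d x0 π t)
          - feedforward A B Q QT R T d (T - (t + 1)) ⬝ᵥ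
              (controlHessian A B Q QT R (T - (t + 1))
                *ᵥ feedforward A B Q QT R T d (T - (t + 1)))
          - (W (t + 1) - W t) := by
    intro t ht
    have htT : t < T := Finset.mem_range.mp ht
    obtain ⟨s, hs⟩ : ∃ s, s = T - (t + 1) := ⟨_, rfl⟩
    have hs1 : T - t = s + 1 := by omega
    have hts : T - (s + 1) = t := by omega
    have hdet : IsUnit (controlHessian A B Q QT R s).det :=
      (Matrix.isUnit_iff_isUnit_det _).mp (controlHessian_posDef hQ hQT hR s).isUnit
    have h := stage_cost_add hR (riccati_posSemidef (A := A) (B := B) hQ hQT hR s) (X t)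
      (d t) (costLinear A B Q QT R T d s) _ (π t (X t)) (feedforward A B Q QT R T d s) rfl
      (by rw [feedforward, mulVec_mulVec, Matrix.mul_nonsing_inv _ hdet, one_mulVec, hts])
    have hnext : X (t + 1) = A *ᵥ X t + B *ᵥ π t (X t) + d t := rfl
    have hlin : costLinear A B Q QT R T d (s + 1) = (A - B * gain A B Q QT R s)ᵀ *ᵥ
        (riccati A B Q QT R s *ᵥ d t + costLinear A B Q QT R T d s) := by
      rw [costLinear, hts]
    simp only [hW, deviation, hs1, ← hs, hnext, hlin, ← hX]
    linarith
  have hWT : W T = X T ⬝ᵥ (QT *ᵥ X T) := by simp [hW, costLinear, riccati]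
  have hW0 : W 0 = x0 ⬝ᵥ (riccati A B Q QT R T *ᵥ x0)
      + 2 * (costLinear A B Q QT R T d T ⬝ᵥ x0) := rfl
  rw [cost, ← hX, Finset.sum_congr rfl hstage, Finset.sum_sub_distrib, Finset.sum_sub_distrib,
    Finset.sum_add_distrib, Finset.sum_range_sub, hWT, hW0, blindValue, blindConst, regret]
  ring

theorem blindCost_eq (hQ : Q.PosSemidef) (hQT : QT.PosSemidef) (hR : R.PosDef)
    (x0 : Fin n → ℝ) : blindCost A B Q QT R T d x0 = blindValue A B Q QT R T d x0 := by
  have hdev (t : ℕ) : deviation A B Q QT R T d x0 (blindPolicy A B Q QT R T) t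
      = feedforward A B Q QT R T d (T - (t + 1)) := by
    simp [deviation, blindPolicy]
  rw [blindCost, cost_eq hQ hQT hR]
  simp only [hdev]
  rw [← regret, sub_add_cancel]

theorem isLeast_range_cost (hQ : Q.PosSemidef) (hQT : QT.PosSemidef) (hR : R.PosDef)
    (x0 : Fin n → ℝ) :
    IsLeast (Set.range (cost A B Q QT R T d x0))
      (blindValue A B Q QT R T d x0 - regret A B Q QT R T d) := by
  refine ⟨⟨offlinePolicy A B Q QT R T d, ?_⟩, ?_⟩
  · have hdev (t : ℕ) : deviation A B Q QT R T d x0 (offlinePolicy A B Q QT R T d) t = 0 := by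
      rw [deviation, offlinePolicy, add_assoc, neg_add_cancel]
    rw [cost_eq hQ hQT hR]
    simp [hdev]
  · rintro _ ⟨π, rfl⟩
    rw [cost_eq hQ hQT hR]
    exact le_add_of_nonneg_right <| Finset.sum_nonneg fun t _ =>
      quadForm_nonneg (controlHessian_posDef hQ hQT hR _).posSemidef _

theorem offlineCost_eq (hQ : Q.PosSemidef) (hQT : QT.PosSemidef) (hR : R.PosDef)
    (x0 : Fin n → ℝ) :
    offlineCost A B Q QT R T d x0
      = blindValue A B Q QT R T d x0 - regret A B Q QT R T d :=
  (isLeast_range_cost hQ hQT hR x0).csInf_eq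

theorem blindCost_sub_offlineCost (hQ : Q.PosSemidef) (hQT : QT.PosSemidef) (hR : R.PosDef)
    (x0 : Fin n → ℝ) :
    blindCost A B Q QT R T d x0 - offlineCost A B Q QT R T d x0 = regret A B Q QT R T d := by
  rw [blindCost_eq hQ hQT hR, offlineCost_eq hQ hQT hR, sub_sub_cancel]

lemma regret_nonneg (hQ : Q.PosSemidef) (hQT : QT.PosSemidef) (hR : R.PosDef) :
    0 ≤ regret A B Q QT R T d :=
  Finset.sum_nonneg fun _ _ => quadForm_nonneg (controlHessian_posDef hQ hQT hR _).posSemidef _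

lemma cost_nonneg (hQ : Q.PosSemidef) (hQT : QT.PosSemidef) (hR : R.PosDef) (x0 : Fin n → ℝ)
    (π : ℕ → (Fin n → ℝ) → (Fin m → ℝ)) : 0 ≤ cost A B Q QT R T d x0 π :=
  add_nonneg (quadForm_nonneg hQT _) <| Finset.sum_nonneg fun _ _ =>
    add_nonneg (quadForm_nonneg hQ _) (quadForm_nonneg hR.posSemidef _)

/-- The regret does not depend on the initial state, so it may be computed from the initial state
zero; there the offline cost is nonnegative and the blind cost is `blindConst`. -/
lemma regret_le_blindConst (hQ : Q.PosSemidef) (hQT : QT.PosSemidef) (hR : R.PosDef) :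
    regret A B Q QT R T d ≤ blindConst A B Q QT R T d := by
  obtain ⟨π, hπ⟩ := (isLeast_range_cost (A := A) (B := B) (T := T) (d := d) hQ hQT hR 0).1
  have h := cost_nonneg (A := A) (B := B) (T := T) (d := d) hQ hQT hR 0 π
  rw [hπ] at h
  simpa [blindValue] using h

/-! ### The size of the regret -/

lemma l2norm_costLinear_le {b : ℝ} (hM : ∀ s, ‖A - B * gain A B Q QT R s‖ ≤ 1)
    (hb : ∀ s, ‖riccati A B Q QT R s‖ ≤ b) {s : ℕ} (hs : s ≤ T) :
    l2norm (costLinear A B Q QT R T d s) ≤ b * ∑ t ∈ Finset.Ico (T - s) T, l2norm (d t) := by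
  induction s with
  | zero => simp [costLinear, l2norm_zero]
  | succ s ih =>
    have hsucc : T - (s + 1) + 1 = T - s := by omega
    rw [Finset.sum_eq_sum_Ico_succ_bot (by omega : T - (s + 1) < T), hsucc, mul_add, costLinear]
    refine (l2norm_mulVec_le _ _).trans ?_
    rw [norm_transpose]
    refine (mul_le_of_le_one_left (l2norm_nonneg _) (hM s)).trans ?_
    refine (l2norm_add_le _ _).trans (add_le_add ?_ (ih (by omega)))
    exact (l2norm_mulVec_le _ _).trans (mul_le_mul_of_nonneg_right (hb s) (l2norm_nonneg _))

lemma blindConst_le {b : ℝ} (hM : ∀ s, ‖A - B * gain A B Q QT R s‖ ≤ 1)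
    (hb : ∀ s, ‖riccati A B Q QT R s‖ ≤ b) :
    blindConst A B Q QT R T d ≤ 3 * b * (∑ t ∈ Finset.range T, l2norm (d t)) ^ 2 := by
  set S := ∑ t ∈ Finset.range T, l2norm (d t) with hS
  have hb0 : 0 ≤ b := (norm_nonneg _).trans (hb 0)
  have hterm : ∀ t ∈ Finset.range T,
      d t ⬝ᵥ (riccati A B Q QT R (T - (t + 1)) *ᵥ d t)
        + 2 * (costLinear A B Q QT R T d (T - (t + 1)) ⬝ᵥ d t) ≤ 3 * b * S * l2norm (d t) := by
    intro t ht
    have hd := l2norm_nonneg (d t)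
    have hdS : l2norm (d t) ≤ S :=
      Finset.single_le_sum (f := fun t => l2norm (d t)) (fun _ _ => l2norm_nonneg _) ht
    have h1 : d t ⬝ᵥ (riccati A B Q QT R (T - (t + 1)) *ᵥ d t) ≤ b * S * l2norm (d t) :=
      calc _ ≤ ‖riccati A B Q QT R (T - (t + 1))‖ * (l2norm (d t) * l2norm (d t)) :=
            dotProduct_mulVec_le _ _ _
        _ ≤ b * (S * l2norm (d t)) := by gcongr; exact hb _
        _ = _ := by ring
    have hq : l2norm (costLinear A B Q QT R T d (T - (t + 1))) ≤ b * S := by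
      refine (l2norm_costLinear_le hM hb (Nat.sub_le _ _)).trans
        (mul_le_mul_of_nonneg_left ?_ hb0)
      refine Finset.sum_le_sum_of_subset_of_nonneg (fun i hi => ?_) fun _ _ _ => l2norm_nonneg _
      exact Finset.mem_range.mpr (Finset.mem_Ico.mp hi).2
    have h2 : costLinear A B Q QT R T d (T - (t + 1)) ⬝ᵥ d t ≤ b * S * l2norm (d t) :=
      (dotProduct_le_l2norm_mul _ _).trans (mul_le_mul_of_nonneg_right hq hd)
    linarith
  refine (Finset.sum_le_sum hterm).trans_eq ?_
  rw [← Finset.mul_sum, ← hS]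
  ring

lemma IsSparseDisturbance.sum_l2norm_le {D : Finset ℕ} {w : ℝ}
    (h : IsSparseDisturbance T D w d) :
    ∑ t ∈ Finset.range T, l2norm (d t) ≤ D.card * w := by
  rw [← Finset.sum_subset h.subset fun t ht htD => by
    rw [h.eq_zero t (Finset.mem_range.mp ht) htD, l2norm_zero], ← nsmul_eq_mul]
  exact Finset.sum_le_card_nsmul D _ w h.norm_le

lemma IsSparseDisturbance.card_mul_nonneg {D : Finset ℕ} {w : ℝ}
    (h : IsSparseDisturbance T D w d) : 0 ≤ D.card * w :=
  (Finset.sum_nonneg fun _ _ => l2norm_nonneg _).trans h.sum_l2norm_le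

/-- The regret is of second order in the disturbances, uniformly in the horizon and in the initial
state. -/
theorem abs_blindCost_sub_offlineCost_le (hQ : Q.PosSemidef) (hQT : QT.PosSemidef)
    (hR : R.PosDef) {b : ℝ} (hM : ∀ s, ‖A - B * gain A B Q QT R s‖ ≤ 1)
    (hb : ∀ s, ‖riccati A B Q QT R s‖ ≤ b) {D : Finset ℕ} {w : ℝ}
    (h : IsSparseDisturbance T D w d) (x0 : Fin n → ℝ) :
    |blindCost A B Q QT R T d x0 - offlineCost A B Q QT R T d x0|
      ≤ 3 * b * ((D.card : ℝ) ^ 2 * w ^ 2) := by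
  have hb0 : 0 ≤ b := (norm_nonneg _).trans (hb 0)
  rw [blindCost_sub_offlineCost hQ hQT hR, abs_of_nonneg (regret_nonneg hQ hQT hR)]
  refine (regret_le_blindConst hQ hQT hR).trans ((blindConst_le hM hb).trans ?_)
  rw [← mul_pow]
  exact mul_le_mul_of_nonneg_left (pow_le_pow_left₀
    (Finset.sum_nonneg fun _ _ => l2norm_nonneg _) h.sum_l2norm_le 2) (by positivity)

end Disturbed

end

end SparseLQR

theorem mainTheorem3 {n m p : ℕ}
    (A : Matrix (Fin n) (Fin n) ℝ) (B : Matrix (Fin n) (Fin m) ℝ)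
    (Q QT : Matrix (Fin n) (Fin n) ℝ) (R : Matrix (Fin m) (Fin m) ℝ)
    (L : Matrix (Fin p) (Fin n) ℝ) (γ : ℝ)
    (hQ : Q.PosSemidef) (hQT : QT.PosSemidef) (hR : R.PosDef)
    (hAB : SparseLQR.Controllable A B)
    (hQL : Q = Lᵀ * L) (hAL : SparseLQR.Observable A L)
    (hγ : 0 < γ) (hstab : ∀ s : ℕ, ‖A - B * SparseLQR.gain A B Q QT R s‖ < 1 - γ) :
    -- the optimal offline policy exists, so the offline cost is the cost of a policy
    (∀ (T : ℕ) (d : ℕ → Fin n → ℝ) (x0 : Fin n → ℝ),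
      IsLeast (Set.range (SparseLQR.cost A B Q QT R T d x0))
        (SparseLQR.offlineCost A B Q QT R T d x0)) ∧
    -- the constants depend on the matrices only, not on the horizon
    (∃ C₁ C₂ : ℝ, 0 ≤ C₁ ∧ 0 ≤ C₂ ∧
      ∀ (T : ℕ) (D : Finset ℕ) (w : ℝ) (d : ℕ → Fin n → ℝ) (x0 : Fin n → ℝ),
        SparseLQR.IsSparseDisturbance T D w d →
        |SparseLQR.blindCost A B Q QT R T d x0 - SparseLQR.offlineCost A B Q QT R T d x0|
          ≤ C₁ * ((D.card : ℝ) * w * SparseLQR.l2norm x0) + C₂ * ((D.card : ℝ) ^ 2 * w ^ 2)) ∧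
    -- the explicit bound, in terms of any uniform bound on the Riccati sequence
    (∃ Phat : ℝ, 1 ≤ Phat ∧ ∀ s : ℕ, ‖SparseLQR.riccati A B Q QT R s‖ ≤ Phat) ∧
    (∀ Phat : ℝ, 1 ≤ Phat → (∀ s : ℕ, ‖SparseLQR.riccati A B Q QT R s‖ ≤ Phat) →
      ∀ (T : ℕ) (D : Finset ℕ) (w : ℝ) (d : ℕ → Fin n → ℝ) (x0 : Fin n → ℝ),
        SparseLQR.IsSparseDisturbance T D w d →
        |SparseLQR.blindCost A B Q QT R T d x0 - SparseLQR.offlineCost A B Q QT R T d x0|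
          ≤ 2 * (D.card : ℝ) * w * Phat * (2 * SparseLQR.l2norm x0 + w)
            + (D.card : ℝ) ^ 2 * w ^ 2 * (2 * Phat ^ 2 + 3 * Phat)
            + (D.card : ℝ) ^ 2 * w * Phat * (3 * Phat * w + (γ ^ 2)⁻¹) * ‖B‖ ^ 2
                / SparseLQR.minEigenvalue R) := by
  have hM : ∀ s, ‖A - B * SparseLQR.gain A B Q QT R s‖ ≤ 1 := fun s => by linarith [hstab s]
  have hbdd : ∃ Phat : ℝ, 1 ≤ Phat ∧ ∀ s : ℕ, ‖SparseLQR.riccati A B Q QT R s‖ ≤ Phat :=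
    SparseLQR.exists_norm_riccati_le hQ hQT hR hγ (hstab 0).le
  refine ⟨fun T d x0 => ?_, ?_, hbdd, ?_⟩
  · rw [SparseLQR.offlineCost_eq hQ hQT hR]
    exact SparseLQR.isLeast_range_cost hQ hQT hR x0
  · obtain ⟨b, hb1, hb⟩ := hbdd
    -- The regret does not depend on `x0`, so no term linear in `x0` is needed.
    refine ⟨0, 3 * b, le_rfl, by linarith, fun T D w d x0 h => ?_⟩
    rw [zero_mul, zero_add]
    exact SparseLQR.abs_blindCost_sub_offlineCost_le hQ hQT hR hM hb h x0
  · intro b hb1 hb T D w d x0 h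
    have hb0 : 0 ≤ b := zero_le_one.trans hb1
    have hx := SparseLQR.l2norm_nonneg x0
    have hmin := SparseLQR.minEigenvalue_nonneg hR.posSemidef
    have hDw := h.card_mul_nonneg
    have hDww : 0 ≤ (D.card : ℝ) * w ^ 2 := by positivity
    refine (SparseLQR.abs_blindCost_sub_offlineCost_le hQ hQT hR hM hb h x0).trans ?_
    -- The term `3 * b * (D.card ^ 2 * w ^ 2)` appears on the right; the others are nonnegative.
    have h1 : 0 ≤ 2 * (D.card : ℝ) * w * b * (2 * SparseLQR.l2norm x0 + w) := by
      have : 0 ≤ b * (4 * ((D.card * w) * SparseLQR.l2norm x0) + 2 * (D.card * w ^ 2)) := by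
        positivity
      linarith
    have h2 : 0 ≤ (D.card : ℝ) ^ 2 * w ^ 2 * (2 * b ^ 2) := by positivity
    have h3 : 0 ≤ (D.card : ℝ) ^ 2 * w * b * (3 * b * w + (γ ^ 2)⁻¹) * ‖B‖ ^ 2
        / SparseLQR.minEigenvalue R := by
      refine div_nonneg (mul_nonneg ?_ (sq_nonneg _)) hmin
      have : 0 ≤ b * (3 * b * (D.card * w) ^ 2 + D.card * (D.card * w) * (γ ^ 2)⁻¹) := by
        positivity
      linarith
    linarith
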